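/- The Apéry numbers are $A_k=\sum_{j=0}^{k}\binom{k}{j}^2\binom{k+j}{j}^2$ for $k\ge 0$. Let $p\ge 5$ be a prime and let $n$ be a positive integer, and let $\nu_p(n)$ denote the $p$-adic order of $n$, i.e. the largest integer $e\ge 0$ with $p^e\mid n$. Then the two numbers on the left-hand sides below are integers, and $$\frac1n\left(\sum_{k=0}^{pn-1}(2k+1)A_k-p\sum_{k=0}^{n-1}(2k+1)A_k\right)\equiv 0\pmod{p^{4+3\nu_p(n)}}$$ and $$\frac1{n^3}\left(\sum_{k=0}^{pn-1}(2k+1)^3A_k-p^3\sum_{k=0}^{n-1}(2k+1)^3A_k\right)\equiv 0\pmod{p^{6+3\nu_p(n)}}.$$ -/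

import Mathlib

/-- The Apéry numbers `A n = ∑_{k=0}^{n} C(n,k)^2 C(n+k,k)^2`. -/
def aperyNumber (n : ℕ) : ℕ :=
  ∑ k ∈ Finset.range (n + 1), (n.choose k) ^ 2 * ((n + k).choose k) ^ 2

/-! Summing over k first telescopes: with x_j = `sqProd n j`, the two sums are n² Σ x_j²/(2j+1) and
n⁶ Σ x_j²/(j+1)³. Replace n by pn and separate the j whose denominator is divisible by p. These
match the terms for n: `sqProd (p * n) J ^ 2` is `sqProd n (J / p) ^ 2` times a product of factors
(1 - (pn)²/l²)² with p ∤ l, and the sums of l⁻² that appear to first order are divisible by the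
denominator itself (`sum_primeToInv_sq`, `sum_primeToInv_sq_half`). The remaining j are immediate
for cubes, where the prefactor is already (pn)⁶. The other sum has only (pn)² in front, so a further
(pn)² must come from cancellation among the 1/(2j+1); this is `sum_sqProd_mul_oddWindow_mem`. -/

open Finset

/-! ### Telescoped forms of the two sums -/

/-- The product `∏_{l=1}^{j} (n² / l² - 1)`, equal to `C(n-1, j) C(n+j, j)`. -/
def sqProd (n : ℚ) (j : ℕ) : ℚ := ∏ l ∈ range j, ((n / (l + 1)) ^ 2 - 1)

lemma sqProd_succ (n : ℚ) (j : ℕ) :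
    sqProd n (j + 1) = sqProd n j * ((n / (j + 1)) ^ 2 - 1) := by
  simp [sqProd, prod_range_succ]

lemma choose_succ_cast (n j : ℕ) :
    ((n.choose (j + 1) : ℕ) : ℚ) * (j + 1) = n.choose j * ((n : ℚ) - j) := by
  rcases le_or_gt j n with h | h
  · have := Nat.choose_succ_right_eq n j
    rw [← Nat.cast_sub h]
    exact_mod_cast this
  · simp [Nat.choose_eq_zero_of_lt h, Nat.choose_eq_zero_of_lt (h.trans (Nat.lt_succ_self j))]

lemma add_choose_succ_cast (n j : ℕ) :
    (((n + (j + 1)).choose (j + 1) : ℕ) : ℚ) * (j + 1) = (n + j).choose j * ((n : ℚ) + j + 1) := by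
  have := Nat.add_one_mul_choose_eq (n + j) j
  have h2 : ((n + j + 1 : ℕ) : ℚ) * (n + j).choose j = (n + j + 1).choose (j + 1) * (j + 1) := by
    exact_mod_cast this
  push_cast at h2
  rw [← add_assoc, ← h2]
  ring

lemma sqProd_eq_choose (m j : ℕ) :
    sqProd (m + 1) j = (m.choose j : ℚ) * ((m + 1 + j).choose j : ℚ) := by
  induction j with
  | zero => simp [sqProd]
  | succ j ih =>
    have h1 := choose_succ_cast m j
    have h2 := add_choose_succ_cast (m + 1) j
    have hj : ((j : ℚ) + 1) ≠ 0 := by positivity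
    rw [sqProd_succ, ih]
    push_cast at h2
    rw [← eq_div_iff hj] at h1 h2
    rw [h1, h2]
    field_simp
    ring

lemma sqProd_self (n : ℕ) (hn : 0 < n) : sqProd n n = 0 := by
  obtain ⟨m, rfl⟩ := Nat.exists_eq_succ_of_ne_zero hn.ne'
  simp [sqProd_succ, div_self (show (m : ℚ) + 1 ≠ 0 by positivity)]

/-- The Apéry number summand `C(k, j) C(k+j, j)`. -/
def chooseProd (k j : ℕ) : ℚ := (k.choose j : ℚ) * ((k + j).choose j : ℚ)

lemma succ_mul_sqProd (k j : ℕ) :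
    ((k : ℚ) + 1) * sqProd (k + 1) j = (k + 1 + j) * chooseProd k j := by
  have h : ((k + j).choose j : ℚ) * (k + j + 1) = (k + 1 + j).choose j * (k + 1) := by
    have := Nat.choose_mul_succ_eq (k + j) j
    rw [show k + j + 1 - j = k + 1 by omega, show k + j + 1 = k + 1 + j by omega] at this
    have h2 : (((k + j).choose j * (k + 1 + j) : ℕ) : ℚ) =
      ((k + 1 + j).choose j * (k + 1) : ℕ) := by exact_mod_cast this
    push_cast at h2
    linarith
  rw [sqProd_eq_choose, chooseProd]
  linear_combination -(k.choose j : ℚ) * h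

lemma mul_sqProd (k j : ℕ) :
    (k : ℚ) * sqProd k j = (k - j) * chooseProd k j := by
  rcases k with _ | k
  · rcases j with _ | j <;> simp [chooseProd]
  · have h : (k.choose j : ℚ) * (k + 1) = (k + 1).choose j * ((k : ℚ) + 1 - j) := by
      rcases le_or_gt j (k + 1) with hj | hj
      · have := Nat.choose_mul_succ_eq k j
        have h2 : ((k.choose j * (k + 1) : ℕ) : ℚ) = ((k + 1).choose j * (k + 1 - j) : ℕ) := by
          exact_mod_cast this
        push_cast [Nat.cast_sub hj] at h2
        exact h2
      · simp [Nat.choose_eq_zero_of_lt hj, Nat.choose_eq_zero_of_lt (show k < j by omega)]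
    push_cast
    rw [sqProd_eq_choose, chooseProd]
    linear_combination ((k + 1 + j).choose j : ℚ) * h

lemma aperyNumber_eq_sum (k n : ℕ) (h : k < n) :
    (aperyNumber k : ℚ) = ∑ j ∈ range n, chooseProd k j ^ 2 := by
  rw [aperyNumber]
  push_cast
  rw [← sum_subset (range_subset_range.2 h)]
  · exact sum_congr rfl fun j _ => by rw [chooseProd]; ring
  · intro j _ hj
    simp only [mem_range, not_lt] at hj
    simp [chooseProd, Nat.choose_eq_zero_of_lt (show k < j by omega)]

lemma sum_mul_aperyNumber (f : ℕ → ℚ) (n : ℕ) :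
    ∑ k ∈ range n, f k * (aperyNumber k : ℚ) =
      ∑ j ∈ range n, ∑ k ∈ range n, f k * chooseProd k j ^ 2 := by
  rw [sum_comm]
  refine sum_congr rfl fun k hk => ?_
  rw [aperyNumber_eq_sum k n (mem_range.1 hk), mul_sum]

/-- Telescoping in n: the increment reduces to (k+1+j)² - (k-j)² = (2k+1)(2j+1). -/
lemma sum_odd_mul_chooseProd_sq (n j : ℕ) :
    ∑ k ∈ range n, (2 * (k : ℚ) + 1) * chooseProd k j ^ 2 =
      n ^ 2 * sqProd n j ^ 2 / (2 * j + 1) := by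
  have hj : (2 * (j : ℚ) + 1) ≠ 0 := by positivity
  induction n with
  | zero => simp
  | succ n ih =>
    rw [sum_range_succ, ih]
    push_cast
    rw [← mul_pow, ← mul_pow, succ_mul_sqProd, mul_sqProd]
    field_simp
    ring

lemma sum_odd_cube_mul_chooseProd_sq (n j : ℕ) :
    ∑ k ∈ range n, (2 * (k : ℚ) + 1) ^ 3 * chooseProd k j ^ 2 =
      n ^ 2 * sqProd n j ^ 2 * (2 * n ^ 2 / (j + 1) - 1) := by
  have hj : ((j : ℚ) + 1) ≠ 0 := by positivity
  induction n with
  | zero => simp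
  | succ n ih =>
    rw [sum_range_succ, ih]
    push_cast
    rw [← mul_pow, ← mul_pow, succ_mul_sqProd, mul_sqProd]
    field_simp
    ring

lemma sum_odd_mul_aperyNumber (n : ℕ) :
    ∑ k ∈ range n, (2 * (k : ℚ) + 1) * (aperyNumber k : ℚ) =
      (n : ℚ) ^ 2 * ∑ j ∈ range n, sqProd n j ^ 2 / (2 * j + 1) := by
  rw [sum_mul_aperyNumber (fun k => 2 * (k : ℚ) + 1), mul_sum]
  exact sum_congr rfl fun j _ => by rw [sum_odd_mul_chooseProd_sq, mul_div_assoc]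

/-- A second telescoping, in j, trades the weight for one whose denominators are cubes. The boundary
term vanishes at M = n by `sqProd_self`. -/
lemma sum_sqProd_telescope (n : ℚ) (M : ℕ) :
    ∑ j ∈ range M, sqProd n j ^ 2 * (2 * n ^ 2 / (j + 1) - 1) =
      ∑ j ∈ range M, n ^ 4 * (sqProd n j ^ 2 / (j + 1) ^ 3) - M * sqProd n M ^ 2 := by
  induction M with
  | zero => simp
  | succ M ih =>
    have hj : ((M : ℚ) + 1) ≠ 0 := by positivity
    rw [sum_range_succ, sum_range_succ, ih, sqProd_succ]
    push_cast
    field_simp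
    ring

lemma sum_odd_cube_mul_aperyNumber (n : ℕ) (hn : 0 < n) :
    ∑ k ∈ range n, (2 * (k : ℚ) + 1) ^ 3 * (aperyNumber k : ℚ) =
      (n : ℚ) ^ 6 * ∑ j ∈ range n, sqProd n j ^ 2 / (j + 1) ^ 3 := by
  have h := sum_sqProd_telescope n n
  rw [sqProd_self n hn, ← mul_sum] at h
  rw [sum_mul_aperyNumber (fun k => (2 * (k : ℚ) + 1) ^ 3)]
  simp_rw [sum_odd_cube_mul_chooseProd_sq, mul_assoc]
  rw [← mul_sum, h]
  ring

/-! ### Integrality of the quotients -/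

lemma exists_int_sqProd (n j : ℕ) (hn : 0 < n) : ∃ z : ℤ, sqProd n j = z := by
  obtain ⟨m, rfl⟩ := Nat.exists_eq_succ_of_ne_zero hn.ne'
  exact ⟨m.choose j * (m + 1 + j).choose j, by push_cast; exact sqProd_eq_choose m j⟩

lemma exists_int_mul_sqProd_div_succ (n j : ℕ) (hn : 0 < n) :
    ∃ z : ℤ, n * sqProd n j / (j + 1) = z := by
  obtain ⟨m, rfl⟩ := Nat.exists_eq_succ_of_ne_zero hn.ne'
  refine ⟨(m + 1).choose (j + 1) * (m + 1 + j).choose j, ?_⟩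
  have h : ((m : ℚ) + 1) * m.choose j = (m + 1).choose (j + 1) * (j + 1) := by
    exact_mod_cast Nat.add_one_mul_choose_eq m j
  push_cast
  rw [sqProd_eq_choose, div_eq_iff (by positivity)]
  linear_combination ((m + 1 + j).choose j : ℚ) * h

/-- By the recurrence `sqProd_succ`, the quotient is the sum of two consecutive values of `sqProd`.
-/
lemma exists_int_sq_mul_sqProd_div_succ_sq (n j : ℕ) (hn : 0 < n) :
    ∃ z : ℤ, n ^ 2 * sqProd n j / (j + 1) ^ 2 = z := by
  obtain ⟨x, hx⟩ := exists_int_sqProd n j hn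
  obtain ⟨y, hy⟩ := exists_int_sqProd n (j + 1) hn
  refine ⟨x + y, ?_⟩
  push_cast
  rw [← hx, ← hy, sqProd_succ]
  field_simp
  ring

lemma exists_int_mul_sqProd_div_odd (n j : ℕ) (hn : 0 < n) :
    ∃ z : ℤ, n * sqProd n j / (2 * j + 1) = z := by
  obtain ⟨m, rfl⟩ := Nat.exists_eq_succ_of_ne_zero hn.ne'
  -- For n = m + 1 this is C(2j, j) C(n+j, 2j+1), the same quotient of factorials when j ≤ m; both
  -- sides vanish when m < j.
  refine ⟨(j + j).choose j * (m + 1 + j).choose (2 * j + 1), ?_⟩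
  push_cast
  rw [sqProd_eq_choose, div_eq_iff (by positivity)]
  rcases lt_or_ge m j with h | h
  · simp [Nat.choose_eq_zero_of_lt h, Nat.choose_eq_zero_of_lt (show m + 1 + j < 2 * j + 1 by omega)]
  · obtain ⟨t, rfl⟩ := Nat.exists_eq_add_of_le h
    have h1 := Nat.add_choose_mul_factorial_mul_factorial t j
    have h2 := Nat.add_choose_mul_factorial_mul_factorial (j + t + 1) j
    have h3 := Nat.add_choose_mul_factorial_mul_factorial j j
    have h4 := Nat.add_choose_mul_factorial_mul_factorial t (2 * j + 1)
    rw [show t + j = j + t by omega] at h1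
    rw [show t + (2 * j + 1) = j + t + 1 + j by omega, Nat.factorial_succ] at h4
    rw [Nat.factorial_succ (j + t)] at h2
    rw [show (2 * j).factorial = (j + j).factorial by rw [two_mul]] at h4
    qify at h1 h2 h3 h4
    have ht : (t.factorial : ℚ) ≠ 0 := by positivity
    have hj : (j.factorial : ℚ) ≠ 0 := by positivity
    have hjt : ((j + t).factorial : ℚ) ≠ 0 := by positivity
    have hjj : ((j + j).factorial : ℚ) ≠ 0 := by positivity
    have e1 : ((j + t).choose j : ℚ) = (j + t).factorial / (t.factorial * j.factorial) := by
      rw [eq_div_iff (by positivity)]; linarith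
    have e2 : ((j + t + 1 + j).choose j : ℚ) =
        (j + t + 1 + j).factorial / ((j + t + 1) * (j + t).factorial * j.factorial) := by
      rw [eq_div_iff (by positivity)]; linarith
    have e3 : ((j + j).choose j : ℚ) = (j + j).factorial / (j.factorial * j.factorial) := by
      rw [eq_div_iff (by positivity)]; linarith
    have e4 : ((j + t + 1 + j).choose (2 * j + 1) : ℚ) =
        (j + t + 1 + j).factorial / (t.factorial * ((2 * j + 1) * (j + j).factorial)) := by
      rw [eq_div_iff (by positivity)]; linarith
    rw [e1, e2, e3, e4]
    push_cast
    have : (j : ℚ) + t + 1 ≠ 0 := by positivity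
    have : 2 * (j : ℚ) + 1 ≠ 0 := by positivity
    field_simp

/-! ### Congruences between p-integral rationals -/

/-- The subring of `p`-integral rational numbers. -/
def pIntegral (p : ℕ) [Fact p.Prime] : Subring ℚ where
  carrier := {x | padicNorm p x ≤ 1}
  mul_mem' {a b} ha hb := by
    simp only [Set.mem_ofPred_eq, padicNorm.mul] at *
    exact mul_le_one₀ ha (padicNorm.nonneg _) hb
  one_mem' := by simp
  add_mem' {a b} ha hb := padicNorm.nonarchimedean.trans (max_le ha hb)
  zero_mem' := by simp
  neg_mem' {a} ha := by simpa [padicNorm.neg] using ha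

/-- The multiples of `M` by `p`-integral rational numbers. -/
def pMultiples (p : ℕ) [Fact p.Prime] (M : ℚ) : AddSubgroup ℚ :=
  (pIntegral p).toAddSubgroup.map (AddMonoidHom.mulLeft M)

/-- The inverse of an integer prime to `p`, and zero on the multiples of `p`. -/
def primeToInv (p : ℕ) (x : ℤ) : ℚ := if (p : ℤ) ∣ x then 0 else (x : ℚ)⁻¹

lemma sum_range_mul_eq (f : ℕ → ℚ) (q m : ℕ) :
    ∑ u ∈ range (q * m), f u = ∑ i ∈ range m, ∑ t ∈ range q, f (q * i + t) := by
  induction m with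
  | zero => simp
  | succ m ih => rw [Nat.mul_succ, sum_range_add, ih, sum_range_succ]

section

variable {p : ℕ} [Fact p.Prime]

lemma mem_pMultiples {M x : ℚ} : x ∈ pMultiples p M ↔ ∃ c ∈ pIntegral p, M * c = x := by
  simp [pMultiples]

lemma mul_mem_pMultiples (M : ℚ) {c : ℚ} (hc : c ∈ pIntegral p) : M * c ∈ pMultiples p M :=
  mem_pMultiples.2 ⟨c, hc, rfl⟩

lemma inv_mem_pIntegral {x : ℤ} (hx : ¬ (p : ℤ) ∣ x) : (x : ℚ)⁻¹ ∈ pIntegral p := by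
  change padicNorm p _ ≤ 1
  have h : padicNorm p ((x : ℚ)⁻¹ * x) = 1 := by
    rw [inv_mul_cancel₀]
    · simp
    · rintro h
      exact hx (by simp [Int.cast_eq_zero.1 h])
  rw [padicNorm.mul, (padicNorm.int_eq_one_iff x).2 hx, mul_one] at h
  exact h.le

lemma primeToInv_mem (x : ℤ) : primeToInv p x ∈ pIntegral p := by
  rw [primeToInv]
  split_ifs with h
  · exact zero_mem _
  · exact inv_mem_pIntegral h

lemma dvd_of_eq_mul_pIntegral {k : ℕ} {z : ℤ} {c : ℚ} (hc : c ∈ pIntegral p)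
    (h : (z : ℚ) = (p : ℚ) ^ k * c) : (p : ℤ) ^ k ∣ z := by
  have h1 : padicNorm p c ≤ 1 := hc
  have h2 := (padicNorm.dvd_iff_norm_le (p := p) (n := k) (z := z)).2 (by
    have hp : padicNorm p ((p : ℚ) ^ k) = (p : ℚ) ^ (-k : ℤ) := by
      rw [IsAbsoluteValue.abv_pow (padicNorm p), padicNorm.padicNorm_p_of_prime, inv_pow,
        zpow_neg, zpow_natCast]
    rw [h, padicNorm.mul, hp]
    exact mul_le_of_le_one_right (by positivity) h1)
  exact_mod_cast h2

/-! ### Sums of inverse squares -/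

lemma primeToInv_sq_congr {M x y : ℤ} (hM : (p : ℤ) ∣ M) (h : M ∣ x - y) :
    primeToInv p x ^ 2 - primeToInv p y ^ 2 ∈ pMultiples p M := by
  have hxy : (p : ℤ) ∣ x ↔ (p : ℤ) ∣ y := (dvd_iff_dvd_of_dvd_sub (hM.trans h))
  by_cases hx : (p : ℤ) ∣ x
  · simp [primeToInv, hx, hxy.1 hx, zero_mem]
  · have hy := mt hxy.2 hx
    obtain ⟨c, hc⟩ := h
    have hc' : (x : ℚ) - y = M * c := by exact_mod_cast hc
    refine mem_pMultiples.2 ⟨-c * (x + y) * ((x : ℚ)⁻¹ ^ 2 * (y : ℚ)⁻¹ ^ 2), ?_, ?_⟩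
    · exact mul_mem (mul_mem (neg_mem (intCast_mem _ _)) (add_mem (intCast_mem _ _)
        (intCast_mem _ _))) (mul_mem (pow_mem (inv_mem_pIntegral hx) 2)
        (pow_mem (inv_mem_pIntegral hy) 2))
    · have hx0 : (x : ℚ) ≠ 0 := by rintro h0; exact hx (by simp [Int.cast_eq_zero.1 h0])
      have hy0 : (y : ℚ) ≠ 0 := by rintro h0; exact hy (by simp [Int.cast_eq_zero.1 h0])
      simp only [primeToInv, hx, hy, if_false]
      field_simp
      linear_combination (x + y : ℚ) * hc'

/-- r ↦ ar + b permutes the residues modulo p^v, and inverse squares respect congruence modulo p^v.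
-/
lemma sum_primeToInv_sq_affine {v : ℕ} (hv : 0 < v) {a : ℤ} (ha : ¬ (p : ℤ) ∣ a) (b : ℤ) :
    ∑ r ∈ range (p ^ v), primeToInv p (a * r + b) ^ 2 -
      ∑ r ∈ range (p ^ v), primeToInv p r ^ 2 ∈ pMultiples p ((p : ℚ) ^ v) := by
  have hp := Fact.out (p := p.Prime)
  have hq : 0 < ((p ^ v : ℕ) : ℤ) := by exact_mod_cast pow_pos hp.pos v
  set q : ℤ := ((p ^ v : ℕ) : ℤ) with hqdef
  have hpq : (p : ℤ) ∣ q := by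
    rw [hqdef]; exact_mod_cast dvd_pow_self p hv.ne'
  have hcop : IsCoprime q a := by
    rw [hqdef]; push_cast
    exact IsCoprime.pow_left ((Prime.coprime_iff_not_dvd (Nat.prime_iff_prime_int.1 hp)).2 ha)
  let σ : ℕ → ℕ := fun r => ((a * r + b) % q).toNat
  have hσ : ∀ r, ((σ r : ℕ) : ℤ) = (a * r + b) % q := fun r =>
    Int.toNat_of_nonneg (Int.emod_nonneg _ hq.ne')
  have hmaps : ∀ r ∈ range (p ^ v), σ r ∈ range (p ^ v) := fun r _ => by
    have := Int.emod_lt_of_pos (a * r + b) hq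
    rw [← hσ] at this
    exact mem_range.2 (Int.ofNat_lt.1 this)
  have hinj : Set.InjOn σ (range (p ^ v)) := fun r hr s hs hrs => by
    have h1 : (a * r + b) % q = (a * s + b) % q := by rw [← hσ, ← hσ, hrs]
    have h2 : q ∣ a * (r - s) := by
      have := Int.ModEq.dvd (show a * s + b ≡ a * r + b [ZMOD q] from h1.symm)
      convert this using 1
      ring
    have h3 : (s : ℤ) ≡ r [ZMOD q] := Int.modEq_iff_dvd.2 (hcop.dvd_of_dvd_mul_left h2)
    exact ((Int.natCast_modEq_iff.1 h3).eq_of_lt_of_lt (mem_range.1 hs) (mem_range.1 hr)).symm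
  have hperm : ∑ r ∈ range (p ^ v), primeToInv p r ^ 2 =
      ∑ r ∈ range (p ^ v), primeToInv p (σ r) ^ 2 := by
    refine (sum_nbij σ hmaps hinj ?_ fun _ _ => rfl).symm
    exact surjOn_of_injOn_of_card_le σ hmaps hinj le_rfl
  rw [hperm, ← sum_sub_distrib]
  refine sum_mem fun r _ => ?_
  have := primeToInv_sq_congr (p := p) (M := q) (x := a * r + b) (y := σ r) hpq
    (by rw [hσ]; exact Int.dvd_self_sub_emod)
  simpa [hqdef] using this

/-- Doubling the residues turns the sum S into S/4, so 3S/4 ≡ 0 modulo p^v; 3 is a unit since p ≥ 5.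
-/
lemma sum_primeToInv_sq_prime_pow (hp5 : 5 ≤ p) (v : ℕ) :
    ∑ r ∈ range (p ^ v), primeToInv p r ^ 2 ∈ pMultiples p ((p : ℚ) ^ v) := by
  have hp := Fact.out (p := p.Prime)
  rcases Nat.eq_zero_or_pos v with rfl | hv
  · simp [primeToInv, zero_mem]
  have h2 : ¬ (p : ℤ) ∣ 2 := fun h => by
    have := Nat.le_of_dvd two_pos (by exact_mod_cast h); omega
  have h3 : ¬ (p : ℤ) ∣ 3 := fun h => by
    have := Nat.le_of_dvd three_pos (by exact_mod_cast h); omega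
  have h := sum_primeToInv_sq_affine hv h2 0
  have hs : ∀ r : ℕ, primeToInv p (2 * r + 0) ^ 2 = primeToInv p r ^ 2 / 4 := fun r => by
    have : (p : ℤ) ∣ 2 * r + 0 ↔ (p : ℤ) ∣ r := by
      rw [add_zero, (Nat.prime_iff_prime_int.1 hp).dvd_mul]; tauto
    simp only [primeToInv, this]
    split_ifs
    · simp
    · push_cast
      rw [add_zero, mul_inv, mul_pow]
      ring
  simp_rw [hs, ← sum_div] at h
  obtain ⟨c, hc, hcS⟩ := mem_pMultiples.1 h
  refine mem_pMultiples.2 ⟨-4 * c * ((3 : ℤ) : ℚ)⁻¹, ?_, ?_⟩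
  · exact mul_mem (mul_mem (neg_mem (ofNat_mem _ 4)) hc) (inv_mem_pIntegral h3)
  · push_cast
    linear_combination (-4 / 3 : ℚ) * hcS

lemma sum_primeToInv_sq (hp5 : 5 ≤ p) {M : ℕ} (hM : 0 < M) :
    ∑ r ∈ range M, primeToInv p r ^ 2 ∈ pMultiples p M := by
  have hp := Fact.out (p := p.Prime)
  obtain ⟨v, m, hm, rfl⟩ := Nat.exists_eq_pow_mul_and_not_dvd hM.ne' p hp.ne_one
  have key : ∑ r ∈ range (p ^ v * m), primeToInv p r ^ 2 ∈ pMultiples p ((p : ℚ) ^ v) := by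
    rw [sum_range_mul_eq (fun r => primeToInv p r ^ 2)]
    refine sum_mem fun i _ => ?_
    rcases Nat.eq_zero_or_pos v with rfl | hv
    · rw [pow_zero]
      refine mem_pMultiples.2 ⟨_, sum_mem fun t _ => pow_mem (primeToInv_mem _) 2, one_mul _⟩
    · have h1 : ¬ (p : ℤ) ∣ 1 := fun h => hp.one_lt.ne' (by
        have := Int.eq_one_of_dvd_one (by positivity) h
        exact_mod_cast this)
      have := add_mem (sum_primeToInv_sq_affine hv h1 ((p ^ v * i : ℕ) : ℤ))
        (sum_primeToInv_sq_prime_pow hp5 v)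
      rw [sub_add_cancel] at this
      convert this using 4
      push_cast; ring
  obtain ⟨c, hc, h⟩ := mem_pMultiples.1 key
  have hm' : ¬ (p : ℤ) ∣ (m : ℤ) := by exact_mod_cast hm
  refine mem_pMultiples.2 ⟨c * ((m : ℤ) : ℚ)⁻¹, mul_mem hc (inv_mem_pIntegral hm'), ?_⟩
  have : (m : ℚ) ≠ 0 := by rintro h0; exact hm (by simp [Nat.cast_eq_zero.1 h0])
  rw [← h]
  push_cast
  field_simp

/-- The reflection l ↦ 2k+1-l pairs the two halves of the full sum modulo 2k+1, inverse squares
being even; 2 is a unit. -/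
lemma sum_primeToInv_sq_half (hp5 : 5 ≤ p) {k : ℕ} (hk : p ∣ 2 * k + 1) :
    ∑ l ∈ range k, primeToInv p (l + 1) ^ 2 ∈ pMultiples p (2 * k + 1) := by
  have hp := Fact.out (p := p.Prime)
  have h2 : ¬ (p : ℤ) ∣ 2 := fun h => by
    have := Nat.le_of_dvd two_pos (by exact_mod_cast h); omega
  have hM := sum_primeToInv_sq hp5 (M := k + 1 + k) (by omega)
  rw [sum_range_add, sum_range_succ', 
    ← sum_range_reflect (fun x => primeToInv p ((k + 1 + x : ℕ) : ℤ) ^ 2)] at hM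
  have hd : ∑ l ∈ range k, (primeToInv p ((k + 1 + (k - 1 - l) : ℕ) : ℤ) ^ 2 -
      primeToInv p (l + 1) ^ 2) ∈ pMultiples p (2 * k + 1) := by
    refine sum_mem fun l hl => ?_
    have hl := mem_range.1 hl
    have e : primeToInv p (l + 1) ^ 2 = primeToInv p (-(l + 1)) ^ 2 := by
      simp only [primeToInv, dvd_neg]
      split_ifs
      · rfl
      · push_cast; rw [inv_neg, neg_sq]
    rw [e]
    have := primeToInv_sq_congr (p := p) (M := 2 * k + 1)
      (x := ((k + 1 + (k - 1 - l) : ℕ) : ℤ)) (y := -(l + 1)) (by exact_mod_cast hk)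
      ⟨1, by omega⟩
    simpa using this
  rw [sum_sub_distrib] at hd
  have hz : primeToInv p 0 = 0 := by simp [primeToInv]
  have hk2 : ((k + 1 + k : ℕ) : ℚ) = 2 * k + 1 := by push_cast; ring
  rw [hk2] at hM
  obtain ⟨c, hc, h⟩ := mem_pMultiples.1 (sub_mem hM hd)
  refine mem_pMultiples.2 ⟨c * ((2 : ℤ) : ℚ)⁻¹, mul_mem hc (inv_mem_pIntegral h2), ?_⟩
  rw [← mul_assoc, h]
  push_cast
  rw [hz]
  ring

end

/-! ### Sums of inverses of odd numbers over windows -/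

/-- The sum of `primeToInv p` over the odd numbers in the window of length `2 p^s` centred at
`p^s (2 i + 1)`. -/
def oddWindow (p s i : ℕ) : ℚ :=
  ∑ r ∈ range (p ^ s), primeToInv p (2 * ((p ^ s * i + r : ℕ) : ℤ) + 1)

lemma not_prime_dvd_int {p k : ℕ} (hk : 0 < k) (hkp : k < p) : ¬ (p : ℤ) ∣ (k : ℤ) := fun h => by
  have := Nat.le_of_dvd hk (by exact_mod_cast h)
  omega

lemma sum_oddWindow (p s i : ℕ) :
    ∑ r ∈ range p, oddWindow p s (p * i + r) = oddWindow p (s + 1) i := by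
  simp only [oddWindow]
  rw [pow_succ, sum_range_mul_eq (fun u => primeToInv p (2 * ((p ^ s * p * i + u : ℕ) : ℤ) + 1))]
  refine sum_congr rfl fun r _ => sum_congr rfl fun t _ => ?_
  congr 4
  ring

lemma mul_add_div_prime {p : ℕ} (i : ℕ) {r : ℕ} (hr : r < p) : (p * i + r) / p = i := by
  rw [Nat.mul_add_div (by omega), Nat.div_eq_of_lt hr, add_zero]

section

variable {p : ℕ} [Fact p.Prime]

/-- For units, 1/x + 1/(M-x) = M/(x(M-x)), and 1/(M-x) ≡ -1/x modulo M. -/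
lemma primeToInv_reflect {M x : ℤ} (hM : (p : ℤ) ∣ M) :
    primeToInv p x + primeToInv p (M - x) + M * primeToInv p x ^ 2 ∈
      pMultiples p ((M : ℚ) ^ 2) := by
  have hxy : (p : ℤ) ∣ M - x ↔ (p : ℤ) ∣ x := by rw [dvd_sub_right hM]
  by_cases hx : (p : ℤ) ∣ x
  · simp [primeToInv, hx, hxy, zero_mem]
  · have hy := mt hxy.1 hx
    have hx0 : (x : ℚ) ≠ 0 := by rintro h0; exact hx (by simp [Int.cast_eq_zero.1 h0])
    have hy0 : ((M - x : ℤ) : ℚ) ≠ 0 := by rintro h0; exact hy (by simp [Int.cast_eq_zero.1 h0])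
    refine mem_pMultiples.2 ⟨(x : ℚ)⁻¹ ^ 2 * ((M - x : ℤ) : ℚ)⁻¹,
      mul_mem (pow_mem (inv_mem_pIntegral hx) 2) (inv_mem_pIntegral hy), ?_⟩
    simp only [primeToInv, hx, hy, if_false]
    push_cast at hy0 ⊢
    field_simp
    ring

/-- The window is symmetric under x ↦ M - x, with M twice its centre. Hence 2W + M Σ x⁻² ≡ 0 modulo
M² for the window sum W, and Σ x⁻² supplies a second factor p^s. -/
lemma oddWindow_mem (hp5 : 5 ≤ p) (s i : ℕ) :
    oddWindow p s i ∈ pMultiples p (((p : ℚ) ^ s) ^ 2) := by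
  rcases Nat.eq_zero_or_pos s with rfl | hs
  · simp only [pow_zero, one_pow]
    exact mem_pMultiples.2 ⟨_, sum_mem fun t _ => primeToInv_mem _, one_mul _⟩
  have h2 : ¬ (p : ℤ) ∣ 2 := not_prime_dvd_int (k := 2) two_pos (by omega)
  let M : ℤ := 2 * p ^ s * (2 * i + 1)
  have hM : (p : ℤ) ∣ M := ((dvd_pow_self _ hs.ne').mul_left 2).mul_right _
  let x : ℕ → ℤ := fun r => 2 * ((p ^ s * i + r : ℕ) : ℤ) + 1
  have hsq : ∑ r ∈ range (p ^ s), primeToInv p (x r) ^ 2 ∈ pMultiples p ((p : ℚ) ^ s) := by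
    have := add_mem (sum_primeToInv_sq_affine hs h2 (2 * p ^ s * i + 1))
      (sum_primeToInv_sq_prime_pow hp5 s)
    rw [sub_add_cancel] at this
    convert this using 4
    simp only [x]
    push_cast; ring
  have hsum : ∑ r ∈ range (p ^ s), (primeToInv p (x r) + primeToInv p (M - x r) +
      M * primeToInv p (x r) ^ 2) ∈ pMultiples p ((M : ℚ) ^ 2) :=
    sum_mem fun r _ => primeToInv_reflect hM
  have hrefl : ∑ r ∈ range (p ^ s), primeToInv p (M - x r) = oddWindow p s i := by
    rw [oddWindow, ← sum_range_reflect]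
    refine sum_congr rfl fun r hr => ?_
    have hr := mem_range.1 hr
    congr 1
    simp only [x, M]
    rw [Nat.sub_sub]
    push_cast [show 1 + r ≤ p ^ s by omega]
    ring
  rw [sum_add_distrib, sum_add_distrib, hrefl, ← mul_sum,
    show ∑ r ∈ range (p ^ s), primeToInv p (x r) = oddWindow p s i from rfl] at hsum
  obtain ⟨c, hc, hcS⟩ := mem_pMultiples.1 hsum
  obtain ⟨d, hd, hdS⟩ := mem_pMultiples.1 hsq
  refine mem_pMultiples.2 ⟨2 * (2 * i + 1) ^ 2 * c - (2 * i + 1) * d, ?_, ?_⟩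
  · have hi : (2 * (i : ℚ) + 1) ∈ pIntegral p := by
      exact_mod_cast natCast_mem (pIntegral p) (2 * i + 1)
    exact sub_mem (mul_mem (mul_mem (ofNat_mem _ 2) (pow_mem hi 2)) hc) (mul_mem hi hd)
  · rw [← hdS] at hcS
    simp only [M] at hcS
    push_cast at hcS
    linear_combination hcS / 2

/-! ### Passing from n to pn -/

/-- Factors whose index is a multiple of p cancel that p and form `sqProd n (J / p)`; at those
indices `primeToInv` is 0, so the product skips them. -/
lemma sqProd_prime_mul (n : ℚ) (J : ℕ) :
    sqProd (p * n) J ^ 2 = sqProd n (J / p) ^ 2 *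
      ∏ l ∈ range J, (1 - (p * n) ^ 2 * primeToInv p (l + 1) ^ 2) ^ 2 := by
  have hp := Fact.out (p := p.Prime)
  have hp0 : (p : ℚ) ≠ 0 := by exact_mod_cast hp.ne_zero
  induction J with
  | zero => simp [sqProd]
  | succ J ih =>
    rw [sqProd_succ, mul_pow, ih, prod_range_succ, Nat.succ_div]
    by_cases h : p ∣ J + 1
    · have h' : (p : ℤ) ∣ (J : ℤ) + 1 := by exact_mod_cast h
      have hJ : ((J : ℚ) + 1) = p * (((J / p : ℕ) : ℚ) + 1) := by
        have h1 := Nat.mul_div_cancel' h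
        rw [Nat.succ_div_of_dvd h] at h1
        exact_mod_cast h1.symm
      simp only [h, h', primeToInv, if_true, sqProd_succ]
      rw [hJ, mul_div_mul_left _ _ hp0]
      ring
    · have h' : ¬ (p : ℤ) ∣ (J : ℤ) + 1 := by exact_mod_cast h
      simp only [h, h', primeToInv, if_false, add_zero]
      push_cast
      rw [div_eq_mul_inv]
      ring

lemma exists_prod_sq_expansion {y : ℚ} (hy : y ∈ pIntegral p) {f : ℕ → ℚ}
    (hf : ∀ l, f l ∈ pIntegral p) (J : ℕ) :
    ∃ c ∈ pIntegral p, ∏ l ∈ range J, (1 - y * f l) ^ 2 =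
      1 - 2 * y * ∑ l ∈ range J, f l + y ^ 2 * c := by
  induction J with
  | zero => exact ⟨0, zero_mem _, by simp⟩
  | succ J ih =>
    obtain ⟨c, hc, h⟩ := ih
    have hF : ∑ l ∈ range J, f l ∈ pIntegral p := sum_mem fun l _ => hf l
    refine ⟨f J ^ 2 + c * (1 - y * f J) ^ 2 +
      2 * f J * (∑ l ∈ range J, f l) * (2 - y * f J), ?_, ?_⟩
    · exact add_mem (add_mem (pow_mem (hf J) 2) (mul_mem hc (pow_mem (sub_mem (one_mem _)
        (mul_mem hy (hf J))) 2))) (mul_mem (mul_mem (mul_mem (ofNat_mem _ 2) (hf J)) hF)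
        (sub_mem (ofNat_mem _ 2) (mul_mem hy (hf J))))
    · rw [prod_range_succ, h, sum_range_succ]
      ring

lemma exists_sqProd_prime_mul_expansion (n J : ℕ) :
    ∃ c ∈ pIntegral p, sqProd (p * n) J ^ 2 = sqProd n (J / p) ^ 2 *
      (1 - 2 * (p * n) ^ 2 * ∑ l ∈ range J, primeToInv p (l + 1) ^ 2 + ((p * n) ^ 2) ^ 2 * c) := by
  have hy : ((p : ℚ) * n) ^ 2 ∈ pIntegral p :=
    pow_mem (mul_mem (natCast_mem _ _) (natCast_mem _ _)) 2
  obtain ⟨c, hc, h⟩ := exists_prod_sq_expansion hy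
    (f := fun l => primeToInv p ((l : ℤ) + 1) ^ 2) (fun l => pow_mem (primeToInv_mem _) 2) J
  exact ⟨c, hc, by rw [sqProd_prime_mul, h]⟩

lemma sqProd_mem (n j : ℕ) (hn : 0 < n) : sqProd n j ∈ pIntegral p := by
  obtain ⟨z, hz⟩ := exists_int_sqProd n j hn
  rw [hz]
  exact intCast_mem _ z

/-- Each descent from N = pN' to N' merges p windows into one of the next level, keeping e + s
fixed; hence the induction for all s. Replacing `sqProd N (p * i + r) ^ 2` by `sqProd N' i ^ 2`
costs a multiple of N², and the window supplies p^(2s). -/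
lemma sum_sqProd_mul_oddWindow_mem (hp5 : 5 ≤ p) (e : ℕ) : ∀ s N : ℕ, 0 < N → p ^ e ∣ N →
    ∑ i ∈ range N, sqProd N i ^ 2 * oddWindow p s i ∈ pMultiples p (((p : ℚ) ^ (e + s)) ^ 2) := by
  induction e with
  | zero =>
    intro s N hN _
    refine sum_mem fun i _ => ?_
    obtain ⟨c, hc, h⟩ := mem_pMultiples.1 (oddWindow_mem hp5 s i)
    refine mem_pMultiples.2 ⟨sqProd N i ^ 2 * c, mul_mem (pow_mem (sqProd_mem N i hN) 2) hc, ?_⟩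
    rw [zero_add, ← h]
    ring
  | succ e ih =>
    intro s N hN hd
    obtain ⟨k, hk⟩ := hd
    let N' := p ^ e * k
    have hNN : N = p * N' := by rw [hk, pow_succ]; ring
    have hN' : 0 < N' := by
      rcases Nat.eq_zero_or_pos N' with h | h
      · rw [h] at hNN; omega
      · exact h
    have hcast : (N : ℚ) = p * N' := by exact_mod_cast hNN
    have hNk : (p : ℚ) * N' = p ^ (e + 1) * k := by
      rw [← hcast]; exact_mod_cast hk
    have hmain := ih (s + 1) N' hN' (Dvd.intro k rfl)
    have hdiff : ∑ i ∈ range N', ∑ r ∈ range p,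
        (sqProd N (p * i + r) ^ 2 - sqProd N' i ^ 2) * oddWindow p s (p * i + r) ∈
        pMultiples p (((p : ℚ) ^ (e + 1 + s)) ^ 2) := by
      refine sum_mem fun i _ => sum_mem fun r hr => ?_
      obtain ⟨c, hc, h⟩ := exists_sqProd_prime_mul_expansion (p := p) N' (p * i + r)
      rw [mul_add_div_prime i (mem_range.1 hr), hNk] at h
      obtain ⟨d, hd, hw⟩ := mem_pMultiples.1 (oddWindow_mem hp5 s (p * i + r))
      have hE : ∑ l ∈ range (p * i + r), primeToInv p ((l : ℤ) + 1) ^ 2 ∈ pIntegral p :=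
        sum_mem fun l _ => pow_mem (primeToInv_mem _) 2
      set E := ∑ l ∈ range (p * i + r), primeToInv p ((l : ℤ) + 1) ^ 2
      refine mem_pMultiples.2 ⟨(k : ℚ) ^ 2 * sqProd N' i ^ 2 *
        (((p : ℚ) ^ (e + 1) * k) ^ 2 * c - 2 * E) * d, ?_, ?_⟩
      · refine mul_mem (mul_mem (mul_mem (pow_mem (natCast_mem _ _) 2)
          (pow_mem (sqProd_mem N' i hN') 2)) (sub_mem (mul_mem (pow_mem (mul_mem
          (pow_mem (natCast_mem _ _) _) (natCast_mem _ _)) 2) hc) (mul_mem (ofNat_mem _ 2) hE))) hd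
      · rw [hcast, hNk, h, ← hw]
        ring
    rw [show e + (s + 1) = e + 1 + s by ring] at hmain
    have htot := add_mem hdiff hmain
    convert htot using 1
    rw [hNN, sum_range_mul_eq (fun u => sqProd ((p * N' : ℕ) : ℚ) u ^ 2 * oddWindow p s u),
      ← sum_add_distrib]
    refine sum_congr rfl fun i _ => ?_
    rw [← sum_oddWindow, mul_sum, ← sum_add_distrib]
    exact sum_congr rfl fun r _ => by ring

lemma sum_sqProd_mul_primeToInv_odd_mem (hp5 : 5 ≤ p) {N : ℕ} (hN : 0 < N) :
    ∑ j ∈ range N, sqProd N j ^ 2 * primeToInv p (2 * j + 1) ∈ pMultiples p ((N : ℚ) ^ 2) := by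
  have hp := Fact.out (p := p.Prime)
  obtain ⟨v, m, hm, rfl⟩ := Nat.exists_eq_pow_mul_and_not_dvd hN.ne' p hp.ne_one
  have h := sum_sqProd_mul_oddWindow_mem hp5 v 0 _ hN (Dvd.intro m rfl)
  obtain ⟨c, hc, h⟩ := mem_pMultiples.1 h
  have hm' : ¬ (p : ℤ) ∣ (m : ℤ) := by exact_mod_cast hm
  have hm0 : (m : ℚ) ≠ 0 := by rintro h0; exact hm (by simp [Nat.cast_eq_zero.1 h0])
  refine mem_pMultiples.2 ⟨c * ((m : ℤ) : ℚ)⁻¹ ^ 2, mul_mem hc (pow_mem (inv_mem_pIntegral hm') 2),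
    ?_⟩
  simp only [oddWindow, pow_zero, one_mul, range_one, sum_singleton, add_zero] at h
  rw [← h]
  push_cast
  field_simp

/-- The first-order term carries p(2i+1), which cancels the denominator. In the second-order term, n
· `sqProd n i` absorbs 2i+1. -/
lemma odd_part_mem (hp5 : 5 ≤ p) {n : ℕ} (hn : 0 < n) (i r : ℕ) (hr : 2 * r + 1 = p) :
    p * (sqProd (p * n) (p * i + r) ^ 2 / (2 * ((p * i + r : ℕ) : ℚ) + 1)) -
      sqProd n i ^ 2 / (2 * i + 1) ∈ pMultiples p ((p : ℚ) ^ 3 * n ^ 2) := by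
  have hM : 2 * (p * i + r) + 1 = p * (2 * i + 1) := by
    have : 2 * (p * i + r) + 1 = p * (2 * i) + (2 * r + 1) := by ring
    rw [this, hr]; ring
  have hM' : 2 * ((p * i + r : ℕ) : ℚ) + 1 = p * (2 * i + 1) := by exact_mod_cast hM
  obtain ⟨c, hc, h⟩ := exists_sqProd_prime_mul_expansion (p := p) n (p * i + r)
  obtain ⟨d, hd, hE⟩ := mem_pMultiples.1 (sum_primeToInv_sq_half hp5 (Dvd.intro _ hM.symm))
  obtain ⟨z, hz⟩ := exists_int_mul_sqProd_div_odd n i hn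
  rw [mul_add_div_prime i (by omega), ← hE, hM'] at h
  have ha := sqProd_mem (p := p) n i hn
  have hi : 2 * (i : ℚ) + 1 ≠ 0 := by positivity
  have hp0 : (p : ℚ) ≠ 0 := by exact_mod_cast (Fact.out (p := p.Prime)).ne_zero
  refine mem_pMultiples.2 ⟨p * n * sqProd n i * z * c - 2 * sqProd n i ^ 2 * d, ?_, ?_⟩
  · exact sub_mem (mul_mem (mul_mem (mul_mem (mul_mem (natCast_mem _ _) (natCast_mem _ _)) ha)
      (intCast_mem _ _)) hc) (mul_mem (mul_mem (ofNat_mem _ 2) (pow_mem ha 2)) hd)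
  · rw [h, hM', ← hz]
    field_simp
    ring

lemma sum_odd_mul_aperyNumber_sub_mem (hp5 : 5 ≤ p) {n : ℕ} (hn : 0 < n) :
    ∑ k ∈ range (p * n), (2 * (k : ℚ) + 1) * (aperyNumber k : ℚ) -
      p * ∑ k ∈ range n, (2 * (k : ℚ) + 1) * (aperyNumber k : ℚ) ∈
      pMultiples p (((p : ℚ) * n) ^ 4) := by
  have hp := Fact.out (p := p.Prime)
  obtain ⟨r, hr⟩ : ∃ r, 2 * r + 1 = p := by
    obtain ⟨r, hr⟩ := hp.odd_of_ne_two (by omega)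
    exact ⟨r, hr.symm⟩
  obtain ⟨c, hc, hT⟩ := mem_pMultiples.1
    (sum_sqProd_mul_primeToInv_odd_mem hp5 (N := p * n) (Nat.mul_pos hp.pos hn))
  have hO := sum_mem (S := pMultiples p ((p : ℚ) ^ 3 * n ^ 2))
    (fun i (_ : i ∈ range n) => odd_part_mem hp5 hn i r hr)
  rw [sum_sub_distrib, ← mul_sum] at hO
  obtain ⟨d, hd, hO⟩ := mem_pMultiples.1 hO
  have hsplit : ∑ j ∈ range (p * n), sqProd ((p * n : ℕ) : ℚ) j ^ 2 / (2 * j + 1) =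
      ∑ j ∈ range (p * n), sqProd ((p * n : ℕ) : ℚ) j ^ 2 * primeToInv p (2 * j + 1) +
      ∑ i ∈ range n, sqProd (p * n) (p * i + r) ^ 2 / (2 * ((p * i + r : ℕ) : ℚ) + 1) := by
    rw [← sub_eq_iff_eq_add', ← sum_sub_distrib, sum_range_mul_eq (fun j =>
      sqProd ((p * n : ℕ) : ℚ) j ^ 2 / (2 * (j : ℚ) + 1) -
        sqProd ((p * n : ℕ) : ℚ) j ^ 2 * primeToInv p (2 * (j : ℤ) + 1))]
    refine sum_congr rfl fun i _ => ?_
    have hdvd : ∀ t : ℕ, (p : ℤ) ∣ 2 * ((p * i + t : ℕ) : ℤ) + 1 ↔ p ∣ 2 * t + 1 := fun t => by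
      have : (p : ℤ) ∣ 2 * ((p * i + t : ℕ) : ℤ) + 1 ↔ p ∣ 2 * (p * i + t) + 1 := by
        exact_mod_cast Iff.rfl
      rw [this, show 2 * (p * i + t) + 1 = p * (2 * i) + (2 * t + 1) by ring]
      exact (Nat.dvd_add_iff_right (Dvd.intro _ rfl)).symm
    -- In each block of p indices only t = r = (p-1)/2 makes 2j+1 divisible by p.
    rw [sum_eq_single_of_mem r (mem_range.2 (by omega))]
    · rw [primeToInv, if_pos ((hdvd r).2 (Dvd.intro 1 (by omega)))]
      push_cast
      ring
    · intro t ht htr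
      have ht := mem_range.1 ht
      have hnd : ¬ p ∣ 2 * t + 1 := by
        rintro ⟨w, hw⟩
        have hw2 : w < 2 := by
          by_contra hcon
          have : p * 2 ≤ p * w := Nat.mul_le_mul_left p (by omega)
          omega
        interval_cases w <;> omega
      rw [primeToInv, if_neg (mt (hdvd t).1 hnd)]
      push_cast
      ring
  rw [sum_odd_mul_aperyNumber, sum_odd_mul_aperyNumber, hsplit, ← hT]
  refine mem_pMultiples.2 ⟨c + d, add_mem hc hd, ?_⟩
  push_cast at hO ⊢
  linear_combination (p : ℚ) * n ^ 2 * hO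

/-! ### The sum with cubes -/

/-- The inverse-square sum cancels one factor i+1 of the cubed denominator; powers of n absorb the
others through the integral quotients z and w. -/
lemma cube_part_mem (hp5 : 5 ≤ p) {n : ℕ} (hn : 0 < n) (i r : ℕ) (hr : r + 1 = p) :
    (n : ℚ) ^ 6 * (p ^ 6 * (sqProd (p * n) (p * i + r) ^ 2 / (((p * i + r : ℕ) : ℚ) + 1) ^ 3) -
      p ^ 3 * (sqProd n i ^ 2 / (i + 1) ^ 3)) ∈ pMultiples p (((p : ℚ) * n) ^ 6) := by
  have hM : p * i + r + 1 = p * (i + 1) := by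
    rw [add_assoc, hr]; ring
  have hM' : ((p * i + r : ℕ) : ℚ) + 1 = p * (i + 1) := by exact_mod_cast hM
  obtain ⟨c, hc, h⟩ := exists_sqProd_prime_mul_expansion (p := p) n (p * i + r)
  have hE := sum_primeToInv_sq hp5 (Nat.succ_pos (p * i + r))
  -- The full sum has length p(i+1), and its term at 0 vanishes.
  rw [Nat.succ_eq_add_one, sum_range_succ'] at hE
  obtain ⟨d, hd, hE⟩ := mem_pMultiples.1 hE
  have hE' : ∑ l ∈ range (p * i + r), primeToInv p ((l : ℤ) + 1) ^ 2 = p * (i + 1) * d := by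
    push_cast at hE hM'
    rw [hM'] at hE
    simpa [primeToInv] using hE.symm
  obtain ⟨z, hz⟩ := exists_int_mul_sqProd_div_succ n i hn
  obtain ⟨w, hw⟩ := exists_int_sq_mul_sqProd_div_succ_sq n i hn
  rw [mul_add_div_prime i (by omega), hE'] at h
  have hi : (i : ℚ) + 1 ≠ 0 := by positivity
  have hp0 : (p : ℚ) ≠ 0 := by exact_mod_cast (Fact.out (p := p.Prime)).ne_zero
  refine mem_pMultiples.2 ⟨p * n * z * w * c - 2 * z ^ 2 * d, ?_, ?_⟩
  · exact sub_mem (mul_mem (mul_mem (mul_mem (mul_mem (natCast_mem _ _) (natCast_mem _ _))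
      (intCast_mem _ _)) (intCast_mem _ _)) hc) (mul_mem (mul_mem (ofNat_mem _ 2)
      (pow_mem (intCast_mem _ _) 2)) hd)
  · rw [h, hM', ← hz, ← hw]
    field_simp
    ring

lemma sum_odd_cube_mul_aperyNumber_sub_mem (hp5 : 5 ≤ p) {n : ℕ} (hn : 0 < n) :
    ∑ k ∈ range (p * n), (2 * (k : ℚ) + 1) ^ 3 * (aperyNumber k : ℚ) -
      (p : ℚ) ^ 3 * ∑ k ∈ range n, (2 * (k : ℚ) + 1) ^ 3 * (aperyNumber k : ℚ) ∈
      pMultiples p (((p : ℚ) * n) ^ 6) := by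
  have hp := Fact.out (p := p.Prime)
  obtain ⟨r, hr⟩ : ∃ r, r + 1 = p := ⟨p - 1, by omega⟩
  have hpn : 0 < p * n := Nat.mul_pos hp.pos hn
  rw [sum_odd_cube_mul_aperyNumber _ hpn, sum_odd_cube_mul_aperyNumber _ hn, sum_range_mul_eq
    (fun j => sqProd ((p * n : ℕ) : ℚ) j ^ 2 / ((j : ℚ) + 1) ^ 3)]
  have hO := sum_mem (S := pMultiples p (((p : ℚ) * n) ^ 6))
    (fun i (_ : i ∈ range n) => cube_part_mem hp5 hn i r hr)
  have hU : ∑ i ∈ range n, ((p : ℚ) * n) ^ 6 * ∑ t ∈ range r,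
      sqProd ((p * n : ℕ) : ℚ) (p * i + t) ^ 2 / (((p * i + t : ℕ) : ℚ) + 1) ^ 3 ∈
      pMultiples p (((p : ℚ) * n) ^ 6) := by
    refine sum_mem fun i _ => mul_mem_pMultiples _ (sum_mem fun t ht => ?_)
    have hnd : ¬ (p : ℤ) ∣ ((p * i + t + 1 : ℕ) : ℤ) := by
      rw [Int.natCast_dvd_natCast, add_assoc, ← Nat.dvd_add_iff_right (Dvd.intro _ rfl)]
      intro h
      have := Nat.le_of_dvd (Nat.succ_pos t) h
      have := mem_range.1 ht
      omega
    have := mul_mem (pow_mem (sqProd_mem (p := p) (p * n) (p * i + t) hpn) 2)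
      (pow_mem (inv_mem_pIntegral hnd) 3)
    rw [div_eq_mul_inv, ← inv_pow]
    exact_mod_cast this
  convert add_mem hU hO using 1
  rw [← sum_add_distrib, mul_sum, mul_sum, mul_sum, ← sum_sub_distrib]
  refine sum_congr rfl fun i _ => ?_
  conv_lhs => rw [show range p = range (r + 1) by rw [hr], sum_range_succ]
  push_cast
  ring

end

/-! ### Global integrality and the theorem -/

lemma exists_int_sum_odd_mul_aperyNumber (n : ℕ) (hn : 0 < n) :
    ∃ z : ℤ, ∑ k ∈ range n, (2 * (k : ℚ) + 1) * (aperyNumber k : ℚ) = n * z := by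
  choose x hx using fun j => exists_int_sqProd n j hn
  choose y hy using fun j => exists_int_mul_sqProd_div_odd n j hn
  refine ⟨∑ j ∈ range n, x j * y j, ?_⟩
  rw [sum_odd_mul_aperyNumber]
  push_cast
  rw [mul_sum, mul_sum]
  refine sum_congr rfl fun j _ => ?_
  rw [← hx, ← hy]
  ring

lemma exists_int_sum_odd_cube_mul_aperyNumber (n : ℕ) (hn : 0 < n) :
    ∃ z : ℤ, ∑ k ∈ range n, (2 * (k : ℚ) + 1) ^ 3 * (aperyNumber k : ℚ) = (n : ℚ) ^ 3 * z := by
  choose x hx using fun j => exists_int_mul_sqProd_div_succ n j hn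
  choose y hy using fun j => exists_int_sq_mul_sqProd_div_succ_sq n j hn
  refine ⟨∑ j ∈ range n, x j * y j, ?_⟩
  rw [sum_odd_cube_mul_aperyNumber n hn]
  push_cast
  rw [mul_sum, mul_sum]
  refine sum_congr rfl fun j _ => ?_
  rw [← hx, ← hy]
  field_simp

theorem theorem1p1 (p : ℕ) (hp : p.Prime) (hp5 : 5 ≤ p) (n : ℕ) (hn : 0 < n) :
    (∃ q : ℤ,
      (1 / (n : ℚ)) *
          (∑ k ∈ Finset.range (p * n), (2 * (k : ℚ) + 1) * (aperyNumber k : ℚ)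
            - (p : ℚ) * ∑ k ∈ Finset.range n, (2 * (k : ℚ) + 1) * (aperyNumber k : ℚ)) = (q : ℚ) ∧
        q ≡ 0 [ZMOD (p : ℤ) ^ (4 + 3 * padicValNat p n)]) ∧
    (∃ q : ℤ,
      (1 / (n : ℚ) ^ 3) *
          (∑ k ∈ Finset.range (p * n), (2 * (k : ℚ) + 1) ^ 3 * (aperyNumber k : ℚ)
            - (p : ℚ) ^ 3 *
              ∑ k ∈ Finset.range n, (2 * (k : ℚ) + 1) ^ 3 * (aperyNumber k : ℚ)) = (q : ℚ) ∧
        q ≡ 0 [ZMOD (p : ℤ) ^ (6 + 3 * padicValNat p n)]) := by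
  have := Fact.mk hp
  have hn0 : (n : ℚ) ≠ 0 := by positivity
  have hpn : 0 < p * n := Nat.mul_pos hp.pos hn
  obtain ⟨m, hm⟩ := pow_padicValNat_dvd (p := p) (n := n)
  have hm' : (n : ℚ) = p ^ padicValNat p n * m := by exact_mod_cast hm
  set v := padicValNat p n
  constructor
  · obtain ⟨z, hz⟩ := exists_int_sum_odd_mul_aperyNumber n hn
    obtain ⟨w, hw⟩ := exists_int_sum_odd_mul_aperyNumber (p * n) hpn
    obtain ⟨c, hc, h⟩ := mem_pMultiples.1 (sum_odd_mul_aperyNumber_sub_mem hp5 hn)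
    have hq : (1 / (n : ℚ)) *
          (∑ k ∈ Finset.range (p * n), (2 * (k : ℚ) + 1) * (aperyNumber k : ℚ)
            - (p : ℚ) * ∑ k ∈ Finset.range n, (2 * (k : ℚ) + 1) * (aperyNumber k : ℚ)) =
        ((p * w - p * z : ℤ) : ℚ) := by
      rw [hz, hw]
      push_cast
      field_simp
    refine ⟨p * w - p * z, hq, Int.modEq_zero_iff_dvd.2
      (dvd_of_eq_mul_pIntegral (c := m ^ 3 * c) (mul_mem (pow_mem (natCast_mem _ _) 3) hc) ?_)⟩
    -- Dividing (pn)⁴ by n leaves p⁴n³; n = p^v m gives the exponent 4 + 3v.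
    rw [← hq, ← h, show 1 / (n : ℚ) * ((p * n) ^ 4 * c) = p ^ 4 * n ^ 3 * c by field_simp, hm']
    ring
  · obtain ⟨z, hz⟩ := exists_int_sum_odd_cube_mul_aperyNumber n hn
    obtain ⟨w, hw⟩ := exists_int_sum_odd_cube_mul_aperyNumber (p * n) hpn
    obtain ⟨c, hc, h⟩ := mem_pMultiples.1 (sum_odd_cube_mul_aperyNumber_sub_mem hp5 hn)
    have hq : (1 / (n : ℚ) ^ 3) *
          (∑ k ∈ Finset.range (p * n), (2 * (k : ℚ) + 1) ^ 3 * (aperyNumber k : ℚ)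
            - (p : ℚ) ^ 3 *
              ∑ k ∈ Finset.range n, (2 * (k : ℚ) + 1) ^ 3 * (aperyNumber k : ℚ)) =
        ((p ^ 3 * w - p ^ 3 * z : ℤ) : ℚ) := by
      rw [hz, hw]
      push_cast
      field_simp
    refine ⟨p ^ 3 * w - p ^ 3 * z, hq, Int.modEq_zero_iff_dvd.2
      (dvd_of_eq_mul_pIntegral (c := m ^ 3 * c) (mul_mem (pow_mem (natCast_mem _ _) 3) hc) ?_)⟩
    rw [← hq, ← h, show 1 / (n : ℚ) ^ 3 * ((p * n) ^ 6 * c) = p ^ 6 * n ^ 3 * c by field_simp, hm']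
    ring
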